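/- Let $s_0,s_1,\dots$ be an irreducible Markov chain on a finite state space $\mathcal S$ with transition matrix $\mathbf P$ and arbitrary initial law; the states are identified with distinct vectors of $\mathbb R^K$. The actions are the channels $\mathcal A=\{1,\dots,K\}$; $\mathcal T_j\subseteq\mathcal A$ is the set of channels that are idle in state $j$, and $A_{j,a}=1$ if $a\in\mathcal T_j$, $A_{j,a}=0$ otherwise. Let the dictionary consist of all pairs $(s_l,a_l)$ with $s_l\in\mathcal S_D$ and $a_l\in\mathcal A$, where $\mathcal S_D\subseteq\mathcal S$ has $N\ge 2$ elements, and let $d_{\min}(\mathcal S)=\min\{\|s-s'\|: s\ne s'\in\mathcal S_D\}$. Let all successful accesses have the same reward $C>0$. The count-based learning algorithm forms, from the numbers $N_s(t)$ of visits to $s$ and $N_{s,j}(t)$ of transitions $s\to j$ observed up to time $t$, $$\alpha^t_{(s,a)}=C\sum_{j:\,a\in\mathcal T_j}\frac{N_{s,j}(t)}{N_s(t)},\qquad Q_t(s,a)=\sum_{l}\alpha^t_{(s_l,a_l)}\,e^{-\left(\|s-s_l\|^2+(a-a_l)^2\right)/(2\sigma^2)}$$ (sum over the dictionary), and in state $s$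 it chooses a maximizer of $Q_t(s,\cdot)$. For $\delta>0$ and $\sigma>0$ consider the condition $$\sigma^2\le\frac{d_{\min}(\mathcal S)^2}{2\ln\left(\frac{N-1}{\delta}\right)}.\qquad(*)$$ (a) For every $\delta>0$ and every $\sigma>0$ with $(*)$ there are numbers $\epsilon_{s,a}\in[0,\delta]$ ($s\in\mathcal S_D$, $a\in\mathcal A$) depending neither on the observed trajectory nor on the initial law nor on $C$, such that almost surely, for all $s\in\mathcal S_D$ and $a\in\mathcal A$, as $t\to\infty$, $$\alpha^t_{(s,a)}\to C\langle P_{s,\cdot},A_{\cdot,a}\rangle,\qquad Q_t(s,a)\to C\sum_{k=1}^K\left(\langle P_{s,\cdot},A_{\cdot,k}\rangle+\epsilon_{s,k}\right)e^{-(a-k)^2/(2\sigma^2)}.$$ (b) For every sufficiently small $\delta>0$ (that is, $\delta\le\delta_0$ with $\delta_0>0$ depending only on the states, $\mathbf P$, $\mathbf A$ and $\mathcal S_D$) and every $\sigma>0$ with $(*)$ there are numbers $\epsilon_{s,a}\in[0,\delta]$ depending neither on the observed trajectory nor on the initial law nor on $C$, such that for every $s\in\mathcal S_D$ the limiting decision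 rule, which maximizes $Q(s,a)=\sum_l C\langle P_{s_l,\cdot},A_{\cdot,a_l}\rangle e^{-(\|s-s_l\|^2+(a-a_l)^2)/(2\sigma^2)}$, has the same set of maximizers as $$\arg\max_{a\in\mathcal A}\left\{\langle P_{s,\cdot},A_{\cdot,a}\rangle+\epsilon_{s,a}\right\},$$ and almost surely, for all large enough $t$ and every $s\in\mathcal S_D$, every maximizer $a$ of $Q_t(s,\cdot)$ belongs to this set and satisfies $\langle P_{s,\cdot},A_{\cdot,a}\rangle\ge\max_{b\in\mathcal A}\langle P_{s,\cdot},A_{\cdot,b}\rangle-\delta$. -/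

import Mathlib

open Filter Topology MeasureTheory
open scoped Matrix
universe u


namespace CBL

noncomputable section

/-- The state-action connectivity matrix: `T j` is the set of channels that are idle in state `j`,
and the entry `(j, a)` is the indicator of `a ∈ T j`. -/
def connectivity {N K : ℕ} (T : Fin N → Finset (Fin K)) : Matrix (Fin N) (Fin K) ℝ :=
  Matrix.of fun j a => if a ∈ T j then 1 else 0

/-- The inner product `⟨P_{s,·}, A_{·,a}⟩` of a row of `P` with a column of `A`. -/
def innerRule {N K : ℕ} (P : Matrix (Fin N) (Fin N) ℝ) (A : Matrix (Fin N) (Fin K) ℝ)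
    (s : Fin N) (a : Fin K) : ℝ :=
  P.row s ⬝ᵥ A.col a

/-- `X` is a time-homogeneous Markov chain with transition matrix `P` and an arbitrary initial law:
the probability of every finite trajectory is multiplied by `P (i t) (i (t+1))` when the trajectory
is extended by one step. -/
structure IsMarkovChain {N : ℕ} {Ω : Type*} [MeasurableSpace Ω] (μ : Measure Ω)
    (P : Matrix (Fin N) (Fin N) ℝ) (X : ℕ → Ω → Fin N) : Prop where
  measurable (t : ℕ) : Measurable (X t)
  extend (t : ℕ) (i : ℕ → Fin N) :
    μ.real {ω | ∀ u ≤ t + 1, X u ω = i u} =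
      μ.real {ω | ∀ u ≤ t, X u ω = i u} * P (i t) (i (t + 1))

/-- The number of transitions `s → j` of the trajectory `x` observed up to time `t`. -/
def transCount {N : ℕ} (x : ℕ → Fin N) (t : ℕ) (s j : Fin N) : ℕ :=
  ((Finset.range t).filter fun u => x u = s ∧ x (u + 1) = j).card

/-- The number of occurrences of the state `s` in the trajectory `x` whose successor has been
observed up to time `t`. -/
def visitCount {N : ℕ} (x : ℕ → Fin N) (t : ℕ) (s : Fin N) : ℕ :=
  ((Finset.range t).filter fun u => x u = s).card

/-- The count-based coefficient `α_{(s,a)}` at time `t`: the reward `C` of a successful access times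
the empirical frequency of the transitions from `s` into a state in which channel `a` is idle. -/
def coeff {N K : ℕ} (C : ℝ) (T : Fin N → Finset (Fin K)) (x : ℕ → Fin N) (t : ℕ)
    (s : Fin N) (a : Fin K) : ℝ :=
  C * ((∑ j ∈ Finset.univ.filter (fun j => a ∈ T j), (transCount x t s j : ℝ)) /
    (visitCount x t s : ℝ))

/-- The Gaussian kernel of width `σ`. -/
def gaussKernel {E : Type*} [NormedAddCommGroup E] (σ : ℝ) (u v : E) : ℝ :=
  Real.exp (-‖u - v‖ ^ 2 / (2 * σ ^ 2))

/-- The state-action pair consisting of the state with power vector `p s` and of channel number `a`,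
as a point of the Euclidean space `ℝ^K × ℝ`. -/
def point {N K : ℕ} (p : Fin N → EuclideanSpace ℝ (Fin K)) (s : Fin N) (a : Fin K) :
    WithLp 2 (EuclideanSpace ℝ (Fin K) × ℝ) :=
  WithLp.toLp 2 (p s, ((a : ℕ) : ℝ))

/-- The kernel expansion `Q(s,a) = ∑_l α_l k((s,a),(s_l,a_l))` over the dictionary of all pairs
of a dictionary state and a channel. -/
def kernelQ {N K : ℕ} (p : Fin N → EuclideanSpace ℝ (Fin K)) (σ : ℝ) (D : Finset (Fin N))
    (α : Fin N → Fin K → ℝ) (s : Fin N) (a : Fin K) : ℝ :=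
  ∑ l ∈ D ×ˢ (Finset.univ : Finset (Fin K)),
    α l.1 l.2 * gaussKernel σ (point p s a) (point p l.1 l.2)

/-- The set of maximizers of a function on the channels. -/
def argmaxSet {K : ℕ} (f : Fin K → ℝ) : Set (Fin K) :=
  {a | ∀ b, f b ≤ f a}

/-- The minimum distance between distinct dictionary states. -/
def dMin {N K : ℕ} (p : Fin N → EuclideanSpace ℝ (Fin K)) (D : Finset (Fin N)) : ℝ :=
  (p '' (D : Set (Fin N))).infsep

/-- The condition on the kernel width. -/
def WidthCondition {N K : ℕ} (p : Fin N → EuclideanSpace ℝ (Fin K)) (D : Finset (Fin N))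
    (σ δ : ℝ) : Prop :=
  σ ^ 2 ≤ dMin p D ^ 2 / (2 * Real.log (((D.card : ℝ) - 1) / δ))

end

end CBL

/-! There are two independent ingredients. The probabilistic one is a law of large numbers along the
visits to a state `s`. The differences between the indicators of a transition into `j` and its
conditional probability are martingale increments. Weighted by 1/n at the n-th visit to `s`, they
sum to a martingale bounded in L², because ∑ 1/n² is finite. This martingale converges almost
surely, and Kronecker's lemma turns the convergence into that of the transition frequencies
(`IsMarkovChain.ae_tendsto_transCount_div`). Infinitely many visits come from Lévy's conditional
Borel–Cantelli lemma, propagated along paths of positive probability.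

The deterministic ingredient is that the Gaussian kernel factors into a state part and a channel
part. At a dictionary state `s` the other N - 1 states each enter with a factor at most δ/(N - 1),
so in total they perturb each coefficient of `s` by an amount in [0, δ]. This `leakage` is the ε of
(a). For (b), the same condition forces σ to 0 with δ, so the mixing of channels fades too, and Q
lies within `smoothingBound` of the coefficients. Once this bound is below every positive gap
between the coefficients of one state, the perturbation only breaks ties. It can then be shrunk into
[0, δ] without changing the maximizers. -/

namespace CBL

/-! ### Deterministic counting along a trajectory -/

section Paths

variable {N : ℕ}

theorem visitCount_succ (x : ℕ → Fin N) (t : ℕ) (s : Fin N) :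
    visitCount x (t + 1) s = visitCount x t s + if x t = s then 1 else 0 := by
  unfold visitCount
  rw [Finset.range_add_one, Finset.filter_insert]
  split_ifs <;> simp

theorem visitCount_cast (x : ℕ → Fin N) (t : ℕ) (s : Fin N) :
    (visitCount x t s : ℝ) = ∑ u ∈ Finset.range t, if x u = s then 1 else 0 := by
  simp [visitCount]

theorem transCount_cast (x : ℕ → Fin N) (t : ℕ) (s j : Fin N) :
    (transCount x t s j : ℝ) =
      ∑ u ∈ Finset.range t, if x u = s then (if x (u + 1) = j then 1 else 0) else 0 := by
  simp [transCount, Finset.filter_and, ← ite_and]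

theorem tendsto_visitCount {x : ℕ → Fin N} {s : Fin N} (h : ∃ᶠ t in atTop, x t = s) :
    Tendsto (fun t => (visitCount x t s : ℝ)) atTop atTop := by
  refine tendsto_natCast_atTop_atTop.comp (tendsto_atTop_atTop_of_monotone ?_ ?_)
  · exact monotone_nat_of_le_succ fun t => by rw [visitCount_succ]; omega
  · intro b
    induction b with
    | zero => exact ⟨0, Nat.zero_le _⟩
    | succ b ih =>
      obtain ⟨a, ha⟩ := ih
      obtain ⟨t, hat, hts⟩ := (frequently_atTop.1 h) a
      have hm : Monotone fun t => visitCount x t s :=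
        monotone_nat_of_le_succ fun t => by rw [visitCount_succ]; omega
      refine ⟨t + 1, ?_⟩
      have := hm hat
      simp only at this
      rw [visitCount_succ, if_pos hts]
      omega

/-- The inverse number of visits to `s`, including the current one, at the times of the visits
to `s`; zero at the other times. -/
noncomputable def visitWeight (x : ℕ → Fin N) (s : Fin N) (t : ℕ) : ℝ :=
  if x t = s then (1 + (visitCount x t s : ℝ))⁻¹ else 0

theorem visitWeight_nonneg (x : ℕ → Fin N) (s : Fin N) (t : ℕ) : 0 ≤ visitWeight x s t := by
  unfold visitWeight; split_ifs <;> positivity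

theorem visitWeight_le_one (x : ℕ → Fin N) (s : Fin N) (t : ℕ) : visitWeight x s t ≤ 1 := by
  unfold visitWeight
  split_ifs
  · exact inv_le_one_of_one_le₀ (by linarith [(visitCount x t s).cast_nonneg (α := ℝ)])
  · exact zero_le_one

/-- The weight at the n-th visit is 1/n, and 1/n² ≤ 2(1/n - 1/(n + 1)) telescopes. -/
theorem sum_visitWeight_sq_le (x : ℕ → Fin N) (s : Fin N) (t : ℕ) :
    ∑ u ∈ Finset.range t, visitWeight x s u ^ 2 ≤ 2 := by
  have key : ∑ u ∈ Finset.range t, visitWeight x s u ^ 2 ≤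
      2 * (1 - (1 + (visitCount x t s : ℝ))⁻¹) := by
    induction t with
    | zero => simp [visitCount]
    | succ t ih =>
      rw [Finset.sum_range_succ, visitCount_succ, visitWeight]
      split_ifs with h
      · have hv := (visitCount x t s).cast_nonneg (α := ℝ)
        push_cast
        generalize (visitCount x t s : ℝ) = v at *
        have : ((1 + v)⁻¹) ^ 2 ≤ 2 * ((1 + v)⁻¹ - (1 + (v + 1))⁻¹) := by
          rw [inv_sub_inv (by positivity) (by positivity), inv_pow, inv_eq_one_div, ← mul_div_assoc,
            div_le_div_iff₀ (by positivity) (by positivity)]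
          nlinarith
        linarith
      · simpa using ih
  have : 0 ≤ (1 + (visitCount x t s : ℝ))⁻¹ := by positivity
  linarith

/-- A form of Kronecker's lemma for sums over the visits to a state. -/
theorem tendsto_sum_visits_div {x : ℕ → Fin N} {s : Fin N} (d : ℕ → ℝ) {c : ℝ}
    (hx : ∃ᶠ t in atTop, x t = s)
    (hd : Tendsto (fun t => ∑ u ∈ Finset.range t, visitWeight x s u * d u) atTop (𝓝 c)) :
    Tendsto (fun t => (∑ u ∈ Finset.range t, if x u = s then d u else 0) / (visitCount x t s : ℝ))
      atTop (𝓝 0) := by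
  set S : ℕ → ℝ := fun t => ∑ u ∈ Finset.range t, visitWeight x s u * d u
  let v : ℕ → ℝ := fun u => if x u = s then 1 else 0
  have hv : 0 ≤ v := fun u => by simp only [v]; split_ifs <;> simp
  have hV := tendsto_visitCount hx
  have hV' : Tendsto (fun t => ∑ u ∈ Finset.range t, v u) atTop atTop :=
    hV.congr fun t => visitCount_cast x t s
  -- Summation by parts. After division by the number of visits, what remains is `S t - c` minus the
  -- average of `S u - c` over the visits, and both tend to 0.
  have parts : ∀ t, (∑ u ∈ Finset.range t, if x u = s then d u else 0) =
      (S t - c) * (visitCount x t s : ℝ) - ∑ u ∈ Finset.range t, v u * (S u - c) := by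
    intro t
    induction t with
    | zero => simp [visitCount]
    | succ t ih =>
      have hS : S (t + 1) = S t + visitWeight x s t * d t := Finset.sum_range_succ _ _
      rw [Finset.sum_range_succ, Finset.sum_range_succ, ih, visitCount_succ, hS]
      simp only [visitWeight, v]
      split_ifs
      · have : 1 + (visitCount x t s : ℝ) ≠ 0 := by positivity
        push_cast
        field_simp
        ring
      · simp
  have hlo : (fun t => ∑ u ∈ Finset.range t, v u * (S u - c)) =o[atTop]
      fun t => ∑ u ∈ Finset.range t, v u := by
    refine Asymptotics.IsLittleO.sum_range ?_ hv hV'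
    have h1 : (fun u => S u - c) =o[atTop] fun _ => (1 : ℝ) :=
      (Asymptotics.isLittleO_one_iff ℝ).2 (tendsto_sub_nhds_zero_iff.2 hd)
    simpa using (Asymptotics.isBigO_refl v atTop).mul_isLittleO h1
  have h2 := hlo.tendsto_div_nhds_zero
  have h3 : Tendsto (fun t => (S t - c) -
      (∑ u ∈ Finset.range t, v u * (S u - c)) / ∑ u ∈ Finset.range t, v u) atTop (𝓝 0) := by
    simpa using (tendsto_sub_nhds_zero_iff.2 hd).sub h2
  refine h3.congr' ?_
  filter_upwards [hV.eventually_gt_atTop 0] with t ht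
  rw [parts, sub_div, mul_div_cancel_right₀ _ ht.ne', visitCount_cast]

end Paths

/-! ### Conditional probabilities given the history -/

section Chain

variable {N : ℕ} {Ω : Type*} [mΩ : MeasurableSpace Ω] {μ : Measure Ω}
  {P : Matrix (Fin N) (Fin N) ℝ} {X : ℕ → Ω → Fin N}

/-- The initial segment up to time `t` of a trajectory. -/
def history (X : ℕ → Ω → Fin N) (t : ℕ) (ω : Ω) : Fin (t + 1) → Fin N := fun u => X u ω

theorem measurable_history (hX : ∀ t, Measurable (X t)) (t : ℕ) : Measurable (history X t) :=
  measurable_pi_lambda _ fun u => hX u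

/-- The filtration generated by a process on a finite state space. -/
def historyFiltration (hX : ∀ t, Measurable (X t)) : Filtration ℕ mΩ where
  seq t := MeasurableSpace.comap (history X t) ⊤
  mono' := by
    intro t t' h
    rintro _ ⟨B, -, rfl⟩
    refine ⟨(fun x : Fin (t' + 1) → Fin N => fun u : Fin (t + 1) => x ⟨u, by omega⟩) ⁻¹' B,
      trivial, rfl⟩
  le' := by
    rintro t _ ⟨B, -, rfl⟩
    exact measurable_history hX t (Set.toFinite B).measurableSet

theorem stronglyMeasurable_comp_history (hX : ∀ t, Measurable (X t)) (t : ℕ)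
    (g : (Fin (t + 1) → Fin N) → ℝ) :
    StronglyMeasurable[historyFiltration hX t] fun ω => g (history X t ω) := by
  have : Measurable[historyFiltration hX t] fun ω => g (history X t ω) := by
    intro B _
    exact ⟨g ⁻¹' B, trivial, rfl⟩
  exact this.stronglyMeasurable

theorem stronglyMeasurable_comp_state (hX : ∀ t, Measurable (X t)) {u t : ℕ} (h : u ≤ t)
    (g : Fin N → ℝ) : StronglyMeasurable[historyFiltration hX t] fun ω => g (X u ω) :=
  stronglyMeasurable_comp_history hX t fun x => g (x ⟨u, by omega⟩)

theorem measurableSet_state (hX : ∀ t, Measurable (X t)) (t : ℕ) (j : Fin N) :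
    MeasurableSet[historyFiltration hX t] {ω | X t ω = j} :=
  ⟨{x | x ⟨t, by omega⟩ = j}, trivial, rfl⟩

theorem stronglyMeasurable_visitWeight (hX : ∀ t, Measurable (X t)) (s : Fin N) (t : ℕ) :
    StronglyMeasurable[historyFiltration hX t] fun ω => visitWeight (fun u => X u ω) s t := by
  have h : (fun ω => visitWeight (fun u => X u ω) s t) = fun ω =>
      (if X t ω = s then 1 else 0) *
        (1 + ∑ u ∈ Finset.range t, if X u ω = s then (1 : ℝ) else 0)⁻¹ := by
    ext ω
    simp [visitWeight, visitCount_cast]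
  rw [h]
  have hm : Measurable[historyFiltration hX t] fun ω =>
      ∑ u ∈ Finset.range t, if X u ω = s then (1 : ℝ) else 0 :=
    Finset.measurable_fun_sum _ fun u hu => (stronglyMeasurable_comp_state hX
      (Finset.mem_range.1 hu).le fun i => if i = s then (1 : ℝ) else 0).measurable
  exact ((stronglyMeasurable_comp_state hX le_rfl fun i =>
    if i = s then (1 : ℝ) else 0).measurable.mul (hm.const_add 1).inv).stronglyMeasurable

/-- On an atom of the history the current state is constant, so both sides are the probability of
the trajectory extended by `j`. No division by the probability of the atom is needed, so null atoms
are harmless. -/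
theorem IsMarkovChain.setIntegral_history [IsProbabilityMeasure μ] (h : IsMarkovChain μ P X)
    (t : ℕ) (j : Fin N) (x : Fin (t + 1) → Fin N) :
    ∫ ω in history X t ⁻¹' {x}, P (X t ω) j ∂μ =
      ∫ ω in history X t ⁻¹' {x}, Set.indicator {ω | X (t + 1) ω = j} (1 : Ω → ℝ) ω ∂μ := by
  have hm : MeasurableSet (history X t ⁻¹' {x}) :=
    measurable_history h.measurable t (Set.toFinite {x}).measurableSet
  have hj : MeasurableSet {ω | X (t + 1) ω = j} := h.measurable (t + 1) (measurableSet_singleton j)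
  have e1 : ∫ ω in history X t ⁻¹' {x}, P (X t ω) j ∂μ =
      ∫ ω in history X t ⁻¹' {x}, P (x (Fin.last t)) j ∂μ := by
    refine setIntegral_congr_fun hm fun ω hω => ?_
    have : history X t ω = x := hω
    simp [← this, history]
  rw [e1, setIntegral_const, integral_indicator_one hj, smul_eq_mul, measureReal_restrict_apply hj]
  -- The trajectory `x` continued by `j`; the values after time `t + 1` play no role.
  let i : ℕ → Fin N := fun u => if hu : u < t + 1 then x ⟨u, hu⟩ else j
  have hi : ∀ ω, (∀ u ≤ t, X u ω = i u) ↔ history X t ω = x := by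
    intro ω
    constructor
    · intro H
      ext1 u
      have := H u (by omega)
      simpa [i, history, Fin.is_le] using this
    · rintro rfl u hu
      simp [i, history, hu]
  have hext := h.extend t i
  have s1 : {ω | ∀ u ≤ t, X u ω = i u} = history X t ⁻¹' {x} := by
    ext ω; simp [hi]
  have s2 : {ω | ∀ u ≤ t + 1, X u ω = i u} = {ω | X (t + 1) ω = j} ∩ history X t ⁻¹' {x} := by
    ext ω
    simp only [Set.mem_ofPred_eq, Set.mem_inter_iff, Set.mem_preimage, Set.mem_singleton_iff, ← hi]
    constructor
    · intro H
      exact ⟨by simpa [i] using H (t + 1) le_rfl, fun u hu => H u (by omega)⟩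
    · rintro ⟨H1, H2⟩ u hu
      rcases Nat.le_succ_iff.1 hu with hu | rfl
      · exact H2 u hu
      · simpa [i] using H1
  rw [s1, s2] at hext
  have i1 : i t = x (Fin.last t) := by simp [i, Fin.last]
  have i2 : i (t + 1) = j := by simp [i]
  rw [hext, i1, i2]

theorem IsMarkovChain.condExp_indicator [IsProbabilityMeasure μ] (h : IsMarkovChain μ P X)
    (t : ℕ) (j : Fin N) :
    μ[Set.indicator {ω | X (t + 1) ω = j} (1 : Ω → ℝ) | historyFiltration h.measurable t]
      =ᵐ[μ] fun ω => P (X t ω) j := by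
  have hj : MeasurableSet {ω | X (t + 1) ω = j} := h.measurable (t + 1) (measurableSet_singleton j)
  have hsm := stronglyMeasurable_comp_state h.measurable (le_refl t) (fun i => P i j)
  have hint : Integrable (fun ω => P (X t ω) j) μ := by
    refine Integrable.of_bound
      (hsm.mono ((historyFiltration h.measurable).le t)).aestronglyMeasurable
      (∑ i, |P i j|) (ae_of_all _ fun ω => ?_)
    exact Finset.single_le_sum (f := fun i => |P i j|) (fun i _ => abs_nonneg _)
      (Finset.mem_univ (X t ω))
  have hint' : Integrable (Set.indicator {ω | X (t + 1) ω = j} (1 : Ω → ℝ)) μ :=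
    (integrable_const (1 : ℝ)).indicator hj
  refine (ae_eq_condExp_of_forall_setIntegral_eq ((historyFiltration h.measurable).le t) hint'
    (fun _ _ _ => hint.integrableOn) ?_ hsm.aestronglyMeasurable).symm
  rintro _ ⟨B, -, rfl⟩ -
  classical
  -- The history takes finitely many values, so each of its events is a finite disjoint union of
  -- atoms.
  have hB : history X t ⁻¹' B = ⋃ x ∈ B.toFinset, history X t ⁻¹' {x} := by
    ext ω; simp
  have hm : ∀ x ∈ B.toFinset, MeasurableSet (history X t ⁻¹' {x}) := fun x _ =>
    measurable_history h.measurable t (Set.toFinite {x}).measurableSet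
  have hd : Set.Pairwise (B.toFinset : Set (Fin (t + 1) → Fin N))
      (Function.onFun Disjoint fun x => history X t ⁻¹' {x}) := fun x _ y _ hxy =>
    (Set.disjoint_singleton.2 hxy).preimage _
  rw [hB, integral_biUnion_finset _ hm hd fun _ _ => hint.integrableOn,
    integral_biUnion_finset _ hm hd fun _ _ => hint'.integrableOn]
  exact Finset.sum_congr rfl fun x _ => h.setIntegral_history t j x

end Chain

theorem innerRule_connectivity {N K : ℕ} (P : Matrix (Fin N) (Fin N) ℝ) (T : Fin N → Finset (Fin K))
    (s : Fin N) (a : Fin K) :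
    innerRule P (connectivity T) s a = ∑ j ∈ Finset.univ.filter (fun j => a ∈ T j), P s j := by
  simp [innerRule, dotProduct, connectivity, Finset.sum_filter]

/-! ### Martingale convergence, recurrence and the law of large numbers -/

section Chain

variable {N : ℕ} {Ω : Type*} [mΩ : MeasurableSpace Ω] {μ : Measure Ω}
  {P : Matrix (Fin N) (Fin N) ℝ} {X : ℕ → Ω → Fin N}

/-- The deviation of the indicator of a transition into `j` from its conditional probability. -/
noncomputable def innovation (P : Matrix (Fin N) (Fin N) ℝ) (j : Fin N) (x : ℕ → Fin N) (t : ℕ) :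
    ℝ :=
  (if x (t + 1) = j then 1 else 0) - P (x t) j

theorem abs_innovation_le (hP : P ∈ Matrix.rowStochastic ℝ (Fin N)) (j : Fin N) (x : ℕ → Fin N)
    (t : ℕ) : |innovation P j x t| ≤ 1 := by
  have h0 := Matrix.nonneg_of_mem_rowStochastic hP (i := x t) (j := j)
  have h1 := Matrix.le_one_of_mem_rowStochastic hP (i := x t) (j := j)
  unfold innovation
  split_ifs <;> rw [abs_le] <;> constructor <;> linarith

theorem stronglyMeasurable_innovation (hX : ∀ t, Measurable (X t)) (P : Matrix (Fin N) (Fin N) ℝ)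
    (j : Fin N) (t : ℕ) :
    StronglyMeasurable[historyFiltration hX (t + 1)] fun ω => innovation P j (fun u => X u ω) t :=
  (stronglyMeasurable_comp_state hX le_rfl fun i => if i = j then (1 : ℝ) else 0).sub
    (stronglyMeasurable_comp_state hX (Nat.le_succ t) fun i => P i j)

theorem integrable_innovation [IsProbabilityMeasure μ] (hX : ∀ t, Measurable (X t))
    (hP : P ∈ Matrix.rowStochastic ℝ (Fin N)) (j : Fin N) (t : ℕ) :
    Integrable (fun ω => innovation P j (fun u => X u ω) t) μ :=
  Integrable.of_bound ((stronglyMeasurable_innovation hX P j t).mono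
    ((historyFiltration hX).le _)).aestronglyMeasurable 1
    (ae_of_all _ fun _ => abs_innovation_le hP j _ t)

theorem IsMarkovChain.condExp_innovation [IsProbabilityMeasure μ] (h : IsMarkovChain μ P X)
    (t : ℕ) (j : Fin N) :
    μ[fun ω => innovation P j (fun u => X u ω) t | historyFiltration h.measurable t] =ᵐ[μ] 0 := by
  have hj : MeasurableSet {ω | X (t + 1) ω = j} := h.measurable (t + 1) (measurableSet_singleton j)
  have hsm := stronglyMeasurable_comp_state h.measurable (le_refl t) (fun i => P i j)
  have hint : Integrable (fun ω => P (X t ω) j) μ := by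
    refine Integrable.of_bound
      (hsm.mono ((historyFiltration h.measurable).le t)).aestronglyMeasurable
      (∑ i, |P i j|) (ae_of_all _ fun ω => ?_)
    exact Finset.single_le_sum (f := fun i => |P i j|) (fun i _ => abs_nonneg _)
      (Finset.mem_univ (X t ω))
  have hint' : Integrable (Set.indicator {ω | X (t + 1) ω = j} (1 : Ω → ℝ)) μ :=
    (integrable_const (1 : ℝ)).indicator hj
  have e : (fun ω => innovation P j (fun u => X u ω) t) =
      Set.indicator {ω | X (t + 1) ω = j} (1 : Ω → ℝ) - fun ω => P (X t ω) j := by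
    ext ω
    simp [innovation, Set.indicator_apply]
  rw [e]
  filter_upwards [condExp_sub hint' hint (historyFiltration h.measurable t),
    h.condExp_indicator t j] with ω h1 h2
  rw [h1, Pi.sub_apply, h2,
    condExp_of_stronglyMeasurable ((historyFiltration h.measurable).le t) hsm hint]
  simp

/-- Innovations are orthogonal to bounded functions of the past. This yields both the martingale
property and the vanishing of the cross terms in the second moment. -/
theorem IsMarkovChain.integral_mul_innovation [IsProbabilityMeasure μ] (h : IsMarkovChain μ P X)
    (hP : P ∈ Matrix.rowStochastic ℝ (Fin N)) (t : ℕ) (j : Fin N) {G : Ω → ℝ} (c : ℝ)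
    (hG : StronglyMeasurable[historyFiltration h.measurable t] G) (hc : ∀ ω, |G ω| ≤ c) :
    ∫ ω, G ω * innovation P j (fun u => X u ω) t ∂μ = 0 := by
  have hle := (historyFiltration h.measurable).le t
  have h1 := condExp_stronglyMeasurable_mul_of_bound (μ := μ) hle hG
    (integrable_innovation h.measurable hP j t) c (ae_of_all _ hc)
  rw [← integral_condExp hle]
  refine integral_eq_zero_of_ae ?_
  filter_upwards [h1, h.condExp_innovation t j] with ω e1 e2
  rw [Pi.mul_apply, e2, Pi.zero_apply, mul_zero] at e1
  exact e1

/-- A sum of innovations with adapted weights of bounded square sum converges. -/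
theorem IsMarkovChain.ae_tendsto_sum_innovation [IsProbabilityMeasure μ] (h : IsMarkovChain μ P X)
    (hP : P ∈ Matrix.rowStochastic ℝ (Fin N)) (j : Fin N) {w : ℕ → Ω → ℝ} {R : ℝ}
    (hw : ∀ t, StronglyMeasurable[historyFiltration h.measurable t] (w t))
    (hw1 : ∀ t ω, |w t ω| ≤ 1) (hR : ∀ t ω, ∑ u ∈ Finset.range t, w u ω ^ 2 ≤ R) :
    ∀ᵐ ω ∂μ, ∃ c, Tendsto (fun t => ∑ u ∈ Finset.range t,
      w u ω * innovation P j (fun v => X v ω) u) atTop (𝓝 c) := by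
  set ℱ := historyFiltration h.measurable
  set D : ℕ → Ω → ℝ := fun t ω => innovation P j (fun v => X v ω) t
  have hD1 : ∀ t ω, |D t ω| ≤ 1 := fun t ω => abs_innovation_le hP j _ t
  have hDm : ∀ t, StronglyMeasurable[ℱ (t + 1)] (D t) :=
    stronglyMeasurable_innovation h.measurable P j
  have hwD1 : ∀ t ω, |w t ω * D t ω| ≤ 1 := fun t ω => by
    rw [abs_mul]
    exact mul_le_one₀ (hw1 t ω) (abs_nonneg _) (hD1 t ω)
  let Z : ℕ → Ω → ℝ := fun t ω => ∑ u ∈ Finset.range t, w u ω * D u ω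
  have hZs : ∀ t ω, Z (t + 1) ω = Z t ω + w t ω * D t ω := fun t ω => Finset.sum_range_succ _ _
  have hZb : ∀ t ω, |Z t ω| ≤ t := fun t ω => by
    refine (Finset.abs_sum_le_sum_abs _ _).trans
      ((Finset.sum_le_sum fun u _ => hwD1 u ω).trans (by simp))
  have hZm : ∀ t, StronglyMeasurable[ℱ t] (Z t) := fun t =>
    Finset.stronglyMeasurable_fun_sum _ fun u hu =>
      ((hw u).mono (ℱ.mono (Finset.mem_range.1 hu).le)).mul
        ((hDm u).mono (ℱ.mono (Finset.mem_range.1 hu)))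
  have hbi : ∀ {t : ℕ} {f : Ω → ℝ} (c : ℝ), StronglyMeasurable[ℱ t] f → (∀ ω, |f ω| ≤ c) →
      Integrable f μ := fun c hf hc =>
    Integrable.of_bound (hf.mono (ℱ.le _)).aestronglyMeasurable c (ae_of_all _ hc)
  have hZi : ∀ t, Integrable (Z t) μ := fun t => hbi t (hZm t) (hZb t)
  have hwDi : ∀ t, Integrable (fun ω => w t ω * D t ω) μ := fun t =>
    hbi (t := t + 1) 1 (((hw t).mono (ℱ.mono (Nat.le_succ t))).mul (hDm t)) (hwD1 t)
  have hmart : Martingale Z ℱ μ := by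
    refine martingale_of_setIntegral_eq_succ hZm hZi fun t s hs => ?_
    have e0 : ∫ ω in s, w t ω * D t ω ∂μ = 0 := by
      rw [← integral_indicator (ℱ.le t s hs)]
      have := h.integral_mul_innovation hP t j (G := s.indicator (w t)) 1 ((hw t).indicator hs)
        (fun ω => by
          by_cases hω : ω ∈ s
          · simpa [hω] using hw1 t ω
          · simp [hω])
      rw [← this]
      congr 1
      ext ω
      by_cases hω : ω ∈ s <;> simp [hω, D]
    simp_rw [hZs]
    rw [integral_add (hZi t).integrableOn (hwDi t).integrableOn, e0, add_zero]
  have hZ2i : ∀ t, Integrable (fun ω => Z t ω ^ 2) μ := fun t =>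
    hbi (t ^ 2 : ℝ) ((hZm t).pow 2) fun ω => by
      rw [abs_pow]; exact pow_le_pow_left₀ (abs_nonneg _) (hZb t ω) 2
  have hw2i : ∀ t, Integrable (fun ω => w t ω ^ 2) μ := fun t =>
    hbi 1 ((hw t).pow 2) fun ω => by
      rw [abs_pow]; exact pow_le_one₀ (abs_nonneg _) (hw1 t ω)
  -- Second moments add up because the cross term `2 * Z t * w t * D t` integrates to 0; the
  -- innovations drop out through `D t ω ^ 2 ≤ 1`.
  have hsq : ∀ t, ∫ ω, Z t ω ^ 2 ∂μ ≤ ∫ ω, ∑ u ∈ Finset.range t, w u ω ^ 2 ∂μ := by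
    intro t
    induction t with
    | zero => simp [Z]
    | succ t ih =>
      have hGb : ∀ ω, |2 * Z t ω * w t ω| ≤ 2 * t := fun ω => by
        rw [abs_mul, abs_mul, abs_two]
        calc 2 * |Z t ω| * |w t ω| ≤ 2 * t * 1 := by
              gcongr
              · exact hZb t ω
              · exact hw1 t ω
          _ = 2 * t := mul_one _
      have hGm : StronglyMeasurable[ℱ t] fun ω => 2 * Z t ω * w t ω :=
        ((hZm t).const_mul 2).mul (hw t)
      have hG := h.integral_mul_innovation hP t j _ hGm hGb
      have hGi : Integrable (fun ω => 2 * Z t ω * w t ω * D t ω) μ :=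
        hbi (t := t + 1) (2 * t : ℝ) ((hGm.mono (ℱ.mono (Nat.le_succ t))).mul (hDm t)) fun ω => by
          rw [abs_mul]
          exact (mul_le_of_le_one_right (abs_nonneg _) (hD1 t ω)).trans (hGb ω)
      calc ∫ ω, Z (t + 1) ω ^ 2 ∂μ
          ≤ ∫ ω, (Z t ω ^ 2 + w t ω ^ 2) + 2 * Z t ω * w t ω * D t ω ∂μ := by
            refine integral_mono (hZ2i _) (((hZ2i t).add (hw2i t)).add hGi) fun ω => ?_
            have : D t ω ^ 2 ≤ 1 := by
              rw [← sq_abs]; exact pow_le_one₀ (abs_nonneg _) (hD1 t ω)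
            simp only [hZs]
            nlinarith [mul_le_mul_of_nonneg_left this (sq_nonneg (w t ω))]
        _ = ∫ ω, Z t ω ^ 2 ∂μ + ∫ ω, w t ω ^ 2 ∂μ := by
            have e1 := integral_add ((hZ2i t).add (hw2i t)) hGi
            have e2 := integral_add (hZ2i t) (hw2i t)
            simp only [Pi.add_apply] at e1
            rw [e1, e2, hG, add_zero]
        _ ≤ ∫ ω, ∑ u ∈ Finset.range t, w u ω ^ 2 ∂μ + ∫ ω, w t ω ^ 2 ∂μ := by gcongr
        _ = ∫ ω, ∑ u ∈ Finset.range (t + 1), w u ω ^ 2 ∂μ := by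
            simp_rw [Finset.sum_range_succ]
            rw [integral_add (integrable_finsetSum _ fun u _ => hw2i u) (hw2i t)]
  have hRb : ∀ t, ∫ ω, Z t ω ^ 2 ∂μ ≤ R := fun t =>
    (hsq t).trans ((integral_mono (integrable_finsetSum _ fun u _ => hw2i u)
      (integrable_const R) (hR t)).trans (by simp))
  -- Doob's theorem needs only an L¹ bound, obtained from |z| ≤ 1 + z².
  refine hmart.submartingale.exists_ae_tendsto_of_bdd (R := (1 + R).toNNReal) fun t => ?_
  rw [eLpNorm_one_eq_lintegral_enorm, ← ofReal_integral_norm_eq_lintegral_enorm (hZi t)]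
  refine ENNReal.ofReal_le_ofReal ?_
  calc ∫ ω, ‖Z t ω‖ ∂μ ≤ ∫ ω, 1 + Z t ω ^ 2 ∂μ := by
        refine integral_mono (hZi t).norm ((integrable_const 1).add (hZ2i t)) fun ω => ?_
        simp only [Real.norm_eq_abs]
        nlinarith [sq_abs (Z t ω), sq_nonneg (|Z t ω| - 1)]
    _ = 1 + ∫ ω, Z t ω ^ 2 ∂μ := by
        rw [integral_add (integrable_const 1) (hZ2i t)]; simp
    _ ≤ 1 + R := by linarith [hRb t]

/-- If a transition `i → j` has positive probability and `i` is visited infinitely often, then so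
is `j`. -/
theorem IsMarkovChain.ae_frequently_of_pos [IsProbabilityMeasure μ] (h : IsMarkovChain μ P X)
    (hP : P ∈ Matrix.rowStochastic ℝ (Fin N)) {i j : Fin N} (hij : 0 < P i j) :
    ∀ᵐ ω ∂μ, (∃ᶠ t in atTop, X t ω = i) → ∃ᶠ t in atTop, X t ω = j := by
  -- Conditional Borel–Cantelli: `j` recurs exactly when the sum of the `P (X t ω) j` diverges, and
  -- this sum is at least `P i j` times the number of visits to `i`.
  have hBC := ae_mem_limsup_atTop_iff μ (ℱ := historyFiltration h.measurable)
    (s := fun t => {ω | X t ω = j}) fun t => measurableSet_state h.measurable t j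
  filter_upwards [hBC, ae_all_iff.2 fun t => h.condExp_indicator t j] with ω h1 h2 hi
  rw [mem_limsup_iff_frequently_mem] at h1
  refine h1.2 ?_
  simp only [h2]
  refine tendsto_atTop_mono (fun t => ?_) ((tendsto_visitCount hi).const_mul_atTop hij)
  rw [visitCount_cast, Finset.mul_sum]
  refine Finset.sum_le_sum fun u _ => ?_
  split_ifs with hu
  · simp [hu]
  · simpa using Matrix.nonneg_of_mem_rowStochastic hP

/-- An irreducible finite Markov chain visits every state infinitely often. -/
theorem IsMarkovChain.ae_frequently [IsProbabilityMeasure μ] (h : IsMarkovChain μ P X)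
    (hP : P ∈ Matrix.rowStochastic ℝ (Fin N)) (hirr : P.IsIrreducible) :
    ∀ᵐ ω ∂μ, ∀ s, ∃ᶠ t in atTop, X t ω = s := by
  have hall : ∀ᵐ ω ∂μ, ∀ i j, 0 < P i j →
      (∃ᶠ t in atTop, X t ω = i) → ∃ᶠ t in atTop, X t ω = j := by
    simp only [ae_all_iff]
    exact fun i j hij => h.ae_frequently_of_pos hP hij
  filter_upwards [hall] with ω hω s
  -- Pigeonhole: with finitely many states, some state recurs. Recurrence then spreads along a path
  -- of positive entries from `i` to `s`.
  obtain ⟨i, hi⟩ : ∃ i, ∃ᶠ t in atTop, X t ω = i := by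
    by_contra! H
    have : ∀ᶠ t in atTop, ∀ i, X t ω ≠ i :=
      eventually_all.2 fun i => H i
    obtain ⟨t, ht⟩ := this.exists
    exact ht _ rfl
  let := P.toQuiver
  obtain ⟨q, -⟩ := hirr.connected i s
  induction q with
  | nil => exact hi
  | cons _ e ih => exact hω _ _ e.down ih

/-- The law of large numbers for the transitions of an irreducible finite Markov chain. -/
theorem IsMarkovChain.ae_tendsto_transCount_div [IsProbabilityMeasure μ] (h : IsMarkovChain μ P X)
    (hP : P ∈ Matrix.rowStochastic ℝ (Fin N)) (hirr : P.IsIrreducible) :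
    ∀ᵐ ω ∂μ, ∀ s j, Tendsto (fun t => (transCount (fun u => X u ω) t s j : ℝ) /
      (visitCount (fun u => X u ω) t s : ℝ)) atTop (𝓝 (P s j)) := by
  have hconv : ∀ᵐ ω ∂μ, ∀ s j, ∃ c, Tendsto (fun t => ∑ u ∈ Finset.range t,
      visitWeight (fun v => X v ω) s u * innovation P j (fun v => X v ω) u) atTop (𝓝 c) := by
    simp only [ae_all_iff]
    intro s j
    refine h.ae_tendsto_sum_innovation hP j (R := 2)
      (stronglyMeasurable_visitWeight h.measurable s) (fun t ω => ?_)
      (fun t ω => sum_visitWeight_sq_le _ s t)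
    rw [abs_of_nonneg (visitWeight_nonneg _ s t)]
    exact visitWeight_le_one _ s t
  filter_upwards [hconv, h.ae_frequently hP hirr] with ω h1 h2 s j
  obtain ⟨c, hc⟩ := h1 s j
  -- At a visit to `s` the innovation is the transition indicator minus the constant `P s j`, so
  -- adding `P s j` to its average over the visits gives the transition frequency.
  have h3 := (tendsto_sum_visits_div _ (h2 s) hc).add_const (P s j)
  rw [zero_add] at h3
  refine h3.congr' ?_
  filter_upwards [(tendsto_visitCount (h2 s)).eventually_gt_atTop 0] with t ht
  rw [div_add' _ _ _ ht.ne']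
  congr 1
  rw [visitCount_cast, transCount_cast, Finset.mul_sum, ← Finset.sum_add_distrib]
  refine Finset.sum_congr rfl fun u _ => ?_
  simp only [innovation]
  split_ifs with h5 h6 <;> simp [h5]

/-- The count-based coefficients converge to the expected rewards. -/
theorem IsMarkovChain.ae_tendsto_coeff [IsProbabilityMeasure μ] (h : IsMarkovChain μ P X)
    (hP : P ∈ Matrix.rowStochastic ℝ (Fin N)) (hirr : P.IsIrreducible) {K : ℕ} (C : ℝ)
    (T : Fin N → Finset (Fin K)) :
    ∀ᵐ ω ∂μ, ∀ s a, Tendsto (fun t => coeff C T (fun u => X u ω) t s a) atTop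
      (𝓝 (C * innerRule P (connectivity T) s a)) := by
  filter_upwards [h.ae_tendsto_transCount_div hP hirr] with ω hω s a
  rw [innerRule_connectivity]
  refine Tendsto.const_mul C ?_
  simp_rw [Finset.sum_div]
  exact tendsto_finsetSum _ fun j _ => hω s j

end Chain

/-! ### Kernel estimates and stability of the maximizers -/

section Rule

variable {N K : ℕ}

theorem innerRule_nonneg {P : Matrix (Fin N) (Fin N) ℝ}
    (hP : P ∈ Matrix.rowStochastic ℝ (Fin N)) (T : Fin N → Finset (Fin K)) (s : Fin N)
    (a : Fin K) : 0 ≤ innerRule P (connectivity T) s a := by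
  rw [innerRule_connectivity]
  exact Finset.sum_nonneg fun j _ => Matrix.nonneg_of_mem_rowStochastic hP

theorem innerRule_le_one {P : Matrix (Fin N) (Fin N) ℝ}
    (hP : P ∈ Matrix.rowStochastic ℝ (Fin N)) (T : Fin N → Finset (Fin K)) (s : Fin N)
    (a : Fin K) : innerRule P (connectivity T) s a ≤ 1 := by
  rw [innerRule_connectivity, ← Matrix.sum_row_of_mem_rowStochastic hP s]
  exact Finset.sum_le_sum_of_subset_of_nonneg (Finset.filter_subset _ _)
    fun j _ _ => Matrix.nonneg_of_mem_rowStochastic hP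

theorem dMin_pos {p : Fin N → EuclideanSpace ℝ (Fin K)} (hp : Function.Injective p)
    {D : Finset (Fin N)} (hD : 2 ≤ D.card) : 0 < dMin p D := by
  have hD' : (D : Set (Fin N)).Nontrivial := by
    obtain ⟨a, ha, b, hb, hab⟩ := Finset.one_lt_card.1 hD
    exact ⟨a, ha, b, hb, hab⟩
  exact (((Finset.finite_toSet D).image p).infsep_pos_iff_nontrivial).2
    (hD'.image hp)

theorem dMin_le {p : Fin N → EuclideanSpace ℝ (Fin K)} (hp : Function.Injective p)
    {D : Finset (Fin N)} {s l : Fin N} (hs : s ∈ D) (hl : l ∈ D) (h : s ≠ l) :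
    dMin p D ≤ ‖p s - p l‖ := by
  rw [← dist_eq_norm]
  exact Set.infsep_le_dist_of_mem
    (Set.mem_image_of_mem p hs) (Set.mem_image_of_mem p hl) (hp.ne h)

theorem WidthCondition.log_le {p : Fin N → EuclideanSpace ℝ (Fin K)} {D : Finset (Fin N)}
    {σ δ : ℝ} (hσ : 0 < σ) (h : WidthCondition p D σ δ) :
    Real.log (((D.card : ℝ) - 1) / δ) ≤ dMin p D ^ 2 / (2 * σ ^ 2) := by
  unfold WidthCondition at h
  have hσ2 : 0 < σ ^ 2 := by positivity
  -- The fraction in the width condition can be cleared only if the logarithm is positive; otherwise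
  -- the bound is trivial.
  rcases le_or_gt (Real.log (((D.card : ℝ) - 1) / δ)) 0 with hL | hL
  · exact hL.trans (by positivity)
  · rw [le_div_iff₀ (by positivity)] at h ⊢
    linarith

theorem WidthCondition.exp_le {p : Fin N → EuclideanSpace ℝ (Fin K)} {D : Finset (Fin N)}
    (hD : 2 ≤ D.card) {σ δ : ℝ} (hσ : 0 < σ) (hδ : 0 < δ) (h : WidthCondition p D σ δ)
    {r : ℝ} (hr : dMin p D ≤ r) :
    Real.exp (-r ^ 2 / (2 * σ ^ 2)) ≤ δ / ((D.card : ℝ) - 1) := by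
  have hn : (0 : ℝ) < (D.card : ℝ) - 1 := by
    have : (2 : ℝ) ≤ D.card := by exact_mod_cast hD
    linarith
  have h0 : 0 ≤ dMin p D := Set.infsep_nonneg
  have h1 : dMin p D ^ 2 / (2 * σ ^ 2) ≤ r ^ 2 / (2 * σ ^ 2) := by gcongr
  have h2 := h.log_le hσ
  rw [← Real.le_log_iff_exp_le (by positivity), neg_div,
    ← inv_div ((D.card : ℝ) - 1) δ, Real.log_inv]
  linarith

/-- Distinct channels are at distance at least 1, so the left side bounds their interaction. The
right side is free of `σ` and vanishes as `δ` tends to 0, which makes the choice of δ₀ uniform in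
`σ`. -/
theorem WidthCondition.exp_neg_inv_le {p : Fin N → EuclideanSpace ℝ (Fin K)} {D : Finset (Fin N)}
    {σ δ : ℝ} (hd : 0 < dMin p D) (hσ : 0 < σ) (h : WidthCondition p D σ δ) :
    Real.exp (-1 / (2 * σ ^ 2)) ≤
      Real.exp (-(Real.log (((D.card : ℝ) - 1) / δ) / dMin p D ^ 2)) := by
  refine Real.exp_le_exp.2 ?_
  rw [neg_div, neg_le_neg_iff, div_le_iff₀ (by positivity), one_div_mul_eq_div]
  exact h.log_le hσ

theorem gaussKernel_point (p : Fin N → EuclideanSpace ℝ (Fin K)) (σ : ℝ) (s l : Fin N)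
    (a k : Fin K) :
    gaussKernel σ (point p s a) (point p l k) =
      Real.exp (-‖p s - p l‖ ^ 2 / (2 * σ ^ 2)) *
        Real.exp (-(((a : ℕ) : ℝ) - ((k : ℕ) : ℝ)) ^ 2 / (2 * σ ^ 2)) := by
  rw [gaussKernel, ← Real.exp_add, WithLp.prod_norm_sq_eq_of_L2]
  congr 1
  simp [point]
  ring

/-- The contribution of the dictionary states other than `s` to the kernel expansion in the
state `s`. -/
noncomputable def leakage (p : Fin N → EuclideanSpace ℝ (Fin K)) (σ : ℝ) (D : Finset (Fin N))
    (g : Fin N → Fin K → ℝ) (s : Fin N) (k : Fin K) : ℝ :=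
  ∑ l ∈ D.erase s, g l k * Real.exp (-‖p s - p l‖ ^ 2 / (2 * σ ^ 2))

/-- The state factor of the kernel is 1 at `l = s`; collecting the other states channel by channel
leaves exactly the leakage. -/
theorem kernelQ_eq_sum_leakage (p : Fin N → EuclideanSpace ℝ (Fin K)) (σ : ℝ)
    {D : Finset (Fin N)} (g : Fin N → Fin K → ℝ) {s : Fin N} (hs : s ∈ D) (a : Fin K) :
    kernelQ p σ D g s a = ∑ k, (g s k + leakage p σ D g s k) *
      Real.exp (-(((a : ℕ) : ℝ) - ((k : ℕ) : ℝ)) ^ 2 / (2 * σ ^ 2)) := by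
  rw [kernelQ, Finset.sum_product_right]
  refine Finset.sum_congr rfl fun k _ => ?_
  simp only [gaussKernel_point]
  rw [← Finset.add_sum_erase _ _ hs, add_mul, leakage, Finset.sum_mul]
  simp [mul_assoc]

theorem kernelQ_const_mul (p : Fin N → EuclideanSpace ℝ (Fin K)) (σ : ℝ) (D : Finset (Fin N))
    (C : ℝ) (g : Fin N → Fin K → ℝ) (s : Fin N) (a : Fin K) :
    kernelQ p σ D (fun s' a' => C * g s' a') s a = C * kernelQ p σ D g s a := by
  simp only [kernelQ, Finset.mul_sum, mul_assoc]

theorem tendsto_kernelQ (p : Fin N → EuclideanSpace ℝ (Fin K)) (σ : ℝ) (D : Finset (Fin N))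
    {α : ℕ → Fin N → Fin K → ℝ} {g : Fin N → Fin K → ℝ}
    (h : ∀ s a, Tendsto (fun t => α t s a) atTop (𝓝 (g s a))) (s : Fin N) (a : Fin K) :
    Tendsto (fun t => kernelQ p σ D (α t) s a) atTop (𝓝 (kernelQ p σ D g s a)) :=
  tendsto_finsetSum _ fun l _ => (h l.1 l.2).mul_const _

theorem leakage_mem_Icc {p : Fin N → EuclideanSpace ℝ (Fin K)} (hp : Function.Injective p)
    {D : Finset (Fin N)} (hD : 2 ≤ D.card) {σ δ : ℝ} (hσ : 0 < σ) (hδ : 0 < δ)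
    (h : WidthCondition p D σ δ) {g : Fin N → Fin K → ℝ} (hg : ∀ s a, g s a ∈ Set.Icc 0 1)
    {s : Fin N} (hs : s ∈ D) (k : Fin K) : leakage p σ D g s k ∈ Set.Icc 0 δ := by
  refine ⟨Finset.sum_nonneg fun l _ => mul_nonneg (hg l k).1 (Real.exp_nonneg _), ?_⟩
  have hn : (0 : ℝ) < (D.card : ℝ) - 1 := by
    have : (2 : ℝ) ≤ D.card := by exact_mod_cast hD
    linarith
  calc leakage p σ D g s k ≤ ∑ _l ∈ D.erase s, δ / ((D.card : ℝ) - 1) := by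
        refine Finset.sum_le_sum fun l hl => ?_
        obtain ⟨hls, hlD⟩ := Finset.mem_erase.1 hl
        exact (mul_le_of_le_one_left (Real.exp_nonneg _) (hg l k).2).trans
          (h.exp_le hD hσ hδ (dMin_le hp hs hlD hls.symm))
    _ = δ := by
        rw [Finset.sum_const, Finset.card_erase_of_mem hs, nsmul_eq_mul,
          Nat.cast_sub (by omega), Nat.cast_one, mul_div_cancel₀ _ hn.ne']

/-- A bound for the distance between the kernel expansion and the coefficients. -/
noncomputable def smoothingBound (K : ℕ) (n d δ : ℝ) : ℝ :=
  δ + K * ((1 + δ) * Real.exp (-(Real.log ((n - 1) / δ) / d ^ 2)))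

theorem tendsto_smoothingBound (K : ℕ) {n d : ℝ} (hn : 1 < n) (hd : 0 < d) :
    Tendsto (smoothingBound K n d) (𝓝[>] 0) (𝓝 0) := by
  have h0 : Tendsto (fun δ : ℝ => δ) (𝓝[>] 0) (𝓝 0) := tendsto_id.mono_left nhdsWithin_le_nhds
  have h1 : Tendsto (fun δ : ℝ => (n - 1) / δ) (𝓝[>] 0) atTop := by
    simpa only [div_eq_mul_inv] using
      tendsto_inv_nhdsGT_zero.const_mul_atTop (sub_pos.2 hn)
  have h2 : Tendsto (fun δ : ℝ => Real.log ((n - 1) / δ) / d ^ 2) (𝓝[>] 0) atTop :=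
    (Real.tendsto_log_atTop.comp h1).atTop_div_const (by positivity)
  have h3 := Real.tendsto_exp_neg_atTop_nhds_zero.comp h2
  unfold smoothingBound
  simpa [Function.comp_def] using
    h0.add (((h0.const_add 1).mul h3).const_mul (K : ℝ))

theorem kernelQ_sub_mem_Icc {p : Fin N → EuclideanSpace ℝ (Fin K)} (hp : Function.Injective p)
    {D : Finset (Fin N)} (hD : 2 ≤ D.card) {σ δ : ℝ} (hσ : 0 < σ) (hδ : 0 < δ)
    (h : WidthCondition p D σ δ) {g : Fin N → Fin K → ℝ} (hg : ∀ s a, g s a ∈ Set.Icc 0 1)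
    {s : Fin N} (hs : s ∈ D) (a : Fin K) :
    kernelQ p σ D g s a - g s a ∈ Set.Icc 0 (smoothingBound K D.card (dMin p D) δ) := by
  have hl := fun k => leakage_mem_Icc hp hD hσ hδ h hg hs k
  -- The channel `k = a` contributes `g s a` plus a leakage of at most `δ`; the remaining sum `R` is
  -- the smoothing over the other channels.
  rw [kernelQ_eq_sum_leakage p σ g hs, ← Finset.add_sum_erase _ _ (Finset.mem_univ a)]
  simp only [sub_self, ne_eq, OfNat.ofNat_ne_zero, not_false_eq_true, zero_pow, neg_zero, zero_div,
    Real.exp_zero, mul_one]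
  set R := ∑ k ∈ Finset.univ.erase a, (g s k + leakage p σ D g s k) *
    Real.exp (-(((a : ℕ) : ℝ) - ((k : ℕ) : ℝ)) ^ 2 / (2 * σ ^ 2))
  have hR0 : 0 ≤ R := Finset.sum_nonneg fun k _ =>
    mul_nonneg (add_nonneg (hg s k).1 (hl k).1) (Real.exp_nonneg _)
  have hR1 : R ≤ K * ((1 + δ) *
      Real.exp (-(Real.log (((D.card : ℝ) - 1) / δ) / dMin p D ^ 2))) := by
    calc R ≤ ∑ _k ∈ Finset.univ.erase a, ((1 + δ) *
          Real.exp (-(Real.log (((D.card : ℝ) - 1) / δ) / dMin p D ^ 2))) := by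
          refine Finset.sum_le_sum fun k hk => ?_
          refine mul_le_mul (add_le_add (hg s k).2 (hl k).2) ?_ (Real.exp_nonneg _) (by positivity)
          refine le_trans ?_ (h.exp_neg_inv_le (dMin_pos hp hD) hσ)
          refine Real.exp_le_exp.2 ?_
          have hak : (1 : ℝ) ≤ (((a : ℕ) : ℝ) - ((k : ℕ) : ℝ)) ^ 2 := by
            have hne : ((a : ℕ) : ℤ) - ((k : ℕ) : ℤ) ≠ 0 := by
              have := Fin.val_ne_of_ne (Finset.ne_of_mem_erase hk)
              omega
            have : (1 : ℤ) ≤ (((a : ℕ) : ℤ) - ((k : ℕ) : ℤ)) ^ 2 :=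
              Int.add_one_le_iff.2 (sq_pos_of_ne_zero hne)
            exact_mod_cast this
          gcongr
      _ ≤ _ := by
          rw [Finset.sum_const, nsmul_eq_mul]
          refine mul_le_mul_of_nonneg_right ?_ (by positivity)
          exact_mod_cast (Finset.card_le_univ _).trans_eq (Fintype.card_fin K)
  have := hl a
  unfold smoothingBound
  constructor <;> linarith [this.1, this.2]

theorem argmaxSet_const_mul {C : ℝ} (hC : 0 < C) (f : Fin K → ℝ) :
    argmaxSet (fun a => C * f a) = argmaxSet f := by
  ext a
  simp [argmaxSet, hC]

/-- Shrinking a perturbation that is smaller than the gaps between the values of a function does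
not change the maximizers. -/
theorem argmaxSet_eq_argmaxSet_add_mul {g q : Fin K → ℝ} {η c : ℝ}
    (hq : ∀ a, q a - g a ∈ Set.Icc 0 η) (hgap : ∀ a b, g a < g b → η < g b - g a)
    (hc : 0 < c) (hc1 : c ≤ 1) :
    argmaxSet q = argmaxSet fun a => g a + c * (q a - g a) := by
  -- Both functions induce the same order on the channels: a strict inequality of `g` survives
  -- because its gap exceeds `η`, and a tie is decided by the perturbation, whose order is
  -- unaffected by the factor `c > 0`.
  have key : ∀ a b, q b ≤ q a ↔ g b + c * (q b - g b) ≤ g a + c * (q a - g a) := by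
    have lt : ∀ a b, g a < g b → q a < q b ∧ g a + c * (q a - g a) < g b + c * (q b - g b) := by
      intro a b hab
      have h1 := hgap a b hab
      have h2 := hq a
      have h3 := hq b
      have h4 : c * (q a - g a) ≤ q a - g a := mul_le_of_le_one_left h2.1 hc1
      have h5 : 0 ≤ c * (q b - g b) := mul_nonneg hc.le h3.1
      constructor <;> linarith [h2.2, h3.1]
    intro a b
    rcases lt_trichotomy (g a) (g b) with hab | hab | hab
    · exact iff_of_false (lt a b hab).1.not_ge (lt a b hab).2.not_ge
    · rw [hab, add_le_add_iff_left, mul_le_mul_iff_right₀ hc, sub_le_sub_iff_right]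
    · exact iff_of_true (lt b a hab).1.le (lt b a hab).2.le
  ext a
  exact forall_congr' fun b => key a b

/-- A channel that is not optimal in the limit is strictly beaten there, and the finitely many
strict inequalities persist for large `t`. -/
theorem eventually_argmaxSet_subset {f : ℕ → Fin K → ℝ} {g : Fin K → ℝ}
    (h : ∀ a, Tendsto (fun t => f t a) atTop (𝓝 (g a))) :
    ∀ᶠ t in atTop, argmaxSet (f t) ⊆ argmaxSet g := by
  have : ∀ᶠ t in atTop, ∀ a b, g a < g b → f t a < f t b := by
    simp only [eventually_all]
    exact fun a b hab => (h a).eventually_lt (h b) hab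
  filter_upwards [this] with t ht a ha b
  by_contra! hb
  exact (ht a b hb).not_ge (ha b)

end Rule

end CBL

/-! ### The convergence theorem and the limiting decision rule -/

theorem theorem4 {N K : ℕ}
    (p : Fin N → EuclideanSpace ℝ (Fin K)) (hp : Function.Injective p)
    (P : Matrix (Fin N) (Fin N) ℝ) (hP : P ∈ Matrix.rowStochastic ℝ (Fin N))
    (hirr : P.IsIrreducible)
    (T : Fin N → Finset (Fin K))
    (D : Finset (Fin N)) (hD : 2 ≤ D.card) :
    -- for every `δ`: the limit of the coefficients and of the learned `Q`-function
    (∀ δ : ℝ, 0 < δ → ∀ σ : ℝ, 0 < σ → CBL.WidthCondition p D σ δ →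
      ∃ ε : Fin N → Fin K → ℝ, (∀ s ∈ D, ∀ a, ε s a ∈ Set.Icc 0 δ) ∧
        ∀ C : ℝ, 0 < C → ∀ (Ω : Type u) [MeasurableSpace Ω] (μ : Measure Ω) [IsProbabilityMeasure μ]
          (X : ℕ → Ω → Fin N), CBL.IsMarkovChain μ P X →
          ∀ᵐ ω ∂μ, ∀ s ∈ D, ∀ a,
            Tendsto (fun t => CBL.coeff C T (fun u => X u ω) t s a) atTop
              (𝓝 (C * CBL.innerRule P (CBL.connectivity T) s a)) ∧
            Tendsto (fun t => CBL.kernelQ p σ D (CBL.coeff C T (fun u => X u ω) t) s a) atTop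
              (𝓝 (C * ∑ k, (CBL.innerRule P (CBL.connectivity T) s k + ε s k) *
                Real.exp (-(((a : ℕ) : ℝ) - ((k : ℕ) : ℝ)) ^ 2 / (2 * σ ^ 2))))) ∧
    -- for all sufficiently small `δ`: the decision rule
    (∃ δ₀ : ℝ, 0 < δ₀ ∧ ∀ δ : ℝ, 0 < δ → δ ≤ δ₀ → ∀ σ : ℝ, 0 < σ → CBL.WidthCondition p D σ δ →
      ∃ ε : Fin N → Fin K → ℝ, (∀ s ∈ D, ∀ a, ε s a ∈ Set.Icc 0 δ) ∧
        (∀ C : ℝ, 0 < C → ∀ s ∈ D,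
          CBL.argmaxSet (CBL.kernelQ p σ D
              (fun s' a' => C * CBL.innerRule P (CBL.connectivity T) s' a') s) =
            CBL.argmaxSet (fun a => CBL.innerRule P (CBL.connectivity T) s a + ε s a)) ∧
        ∀ C : ℝ, 0 < C → ∀ (Ω : Type u) [MeasurableSpace Ω] (μ : Measure Ω) [IsProbabilityMeasure μ]
          (X : ℕ → Ω → Fin N), CBL.IsMarkovChain μ P X →
          ∀ᵐ ω ∂μ, ∀ᶠ t in atTop, ∀ s ∈ D,
            ∀ a ∈ CBL.argmaxSet (CBL.kernelQ p σ D (CBL.coeff C T (fun u => X u ω) t) s),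
              a ∈ CBL.argmaxSet (fun b => CBL.innerRule P (CBL.connectivity T) s b + ε s b) ∧
              ∀ b, CBL.innerRule P (CBL.connectivity T) s b ≤
                CBL.innerRule P (CBL.connectivity T) s a + δ) := by
  have hg : ∀ s a, CBL.innerRule P (CBL.connectivity T) s a ∈ Set.Icc (0 : ℝ) 1 := fun s a =>
    ⟨CBL.innerRule_nonneg hP T s a, CBL.innerRule_le_one hP T s a⟩
  set g := CBL.innerRule P (CBL.connectivity T)
  constructor
  · intro δ hδ σ hσ hw
    refine ⟨CBL.leakage p σ D g, fun s hs a => CBL.leakage_mem_Icc hp hD hσ hδ hw hg hs a, ?_⟩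
    intro C _ Ω _ μ _ X hX
    filter_upwards [hX.ae_tendsto_coeff hP hirr C T] with ω hω s hs a
    refine ⟨hω s a, ?_⟩
    rw [← CBL.kernelQ_eq_sum_leakage p σ g hs, ← CBL.kernelQ_const_mul]
    exact CBL.tendsto_kernelQ p σ D hω s a
  · have hn : (1 : ℝ) < D.card := by exact_mod_cast hD
    -- There are finitely many positive gaps, and the smoothing bound tends to 0, so one δ₀ serves
    -- them all.
    have hsmall : ∀ᶠ δ in 𝓝[>] (0 : ℝ), ∀ s a b, g s a < g s b →
        CBL.smoothingBound K D.card (CBL.dMin p D) δ < g s b - g s a := by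
      simp only [eventually_all]
      exact fun s a b hab => (CBL.tendsto_smoothingBound K hn (CBL.dMin_pos hp hD)).eventually
        (gt_mem_nhds (sub_pos.2 hab))
    obtain ⟨δ₀, hδ₀, hsub⟩ := mem_nhdsGT_iff_exists_Ioc_subset.1 hsmall
    refine ⟨δ₀, hδ₀, fun δ hδ hδδ₀ σ hσ hw => ?_⟩
    have hgap := hsub ⟨hδ, hδδ₀⟩
    set η := CBL.smoothingBound K D.card (CBL.dMin p D) δ
    have hδη : δ ≤ η := le_add_of_nonneg_right (by positivity)
    have hη : 0 < η := hδ.trans_le hδη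
    have hq := fun s hs a => CBL.kernelQ_sub_mem_Icc hp hD hσ hδ hw hg (s := s) hs a
    -- The full perturbation, including the mixing of channels, lies in [0, `η`]; the factor `δ / η
    -- ≤ 1` brings it into [0, `δ`]. It is built from `g` alone, hence is independent of `C` and of
    -- the chain's trajectory and initial law.
    let ε : Fin N → Fin K → ℝ := fun s a => δ / η * (CBL.kernelQ p σ D g s a - g s a)
    have hε : ∀ s ∈ D, ∀ a, ε s a ∈ Set.Icc 0 δ := fun s hs a => by
      refine ⟨mul_nonneg (by positivity) (hq s hs a).1, ?_⟩
      calc ε s a ≤ δ / η * η := by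
            exact mul_le_mul_of_nonneg_left (hq s hs a).2 (by positivity)
        _ = δ := div_mul_cancel₀ _ hη.ne'
    have harg : ∀ C : ℝ, 0 < C → ∀ s ∈ D,
        CBL.argmaxSet (CBL.kernelQ p σ D (fun s' a' => C * g s' a') s) =
          CBL.argmaxSet (fun a => g s a + ε s a) := by
      intro C hC s hs
      have e : CBL.kernelQ p σ D (fun s' a' => C * g s' a') s =
          fun a => C * CBL.kernelQ p σ D g s a :=
        funext fun a => CBL.kernelQ_const_mul p σ D C g s a
      rw [e, CBL.argmaxSet_const_mul hC]
      exact CBL.argmaxSet_eq_argmaxSet_add_mul (hq s hs) (hgap s) (by positivity)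
        ((div_le_one hη).2 hδη)
    refine ⟨ε, hε, harg, fun C hC Ω _ μ _ X hX => ?_⟩
    filter_upwards [hX.ae_tendsto_coeff hP hirr C T] with ω hω
    have hev : ∀ᶠ t in atTop, ∀ s,
        CBL.argmaxSet (CBL.kernelQ p σ D (CBL.coeff C T (fun u => X u ω) t) s) ⊆
          CBL.argmaxSet (CBL.kernelQ p σ D (fun s' a' => C * g s' a') s) :=
      eventually_all.2 fun s => CBL.eventually_argmaxSet_subset fun a =>
        CBL.tendsto_kernelQ p σ D hω s a
    filter_upwards [hev] with t ht s hs a ha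
    have hmem : a ∈ CBL.argmaxSet (fun b => g s b + ε s b) := harg C hC s hs ▸ ht s ha
    refine ⟨hmem, fun b => ?_⟩
    have h1 : g s b + ε s b ≤ g s a + ε s a := hmem b
    -- The chain is g(b) ≤ g(b) + ε(b) ≤ g(a) + ε(a) ≤ g(a) + δ.
    linarith [(hε s hs a).2, (hε s hs b).1]
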